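/- Let $\mathbb K\in\{\mathbb R,\mathbb C\}$, let $\Omega$ be a non-empty set, and let $\mathcal F(\Omega)$ be a linear subspace of $\mathbb K^{\Omega}$ with a norm $\|\cdot\|$. Let $\tau$ be a locally convex Hausdorff topology on $\mathcal F(\Omega)$ that is coarser than the norm topology and finer than the topology $\tau_{\mathrm p}$ of pointwise convergence on $\Omega$. Let $\gamma$ be the mixed topology, that is, the finest linear topology on $\mathcal F(\Omega)$ that lies between $\tau$ and the norm topology and coincides with $\tau$ on norm-bounded sets. Suppose that $(\mathcal F(\Omega),\|\cdot\|,\tau)$ is a semi-reflexive Saks space, i.e. $\tau$ is generated by a directed system $\Gamma_\tau$ of continuous seminorms with $\|f\|=\sup_{q\in\Gamma_\tau}q(f)$ for all $f\in\mathcal F(\Omega)$, and $(\mathcal F(\Omega),\gamma)$ is semi-reflexive (every continuous linear functional on its strong dual is the evaluation at some element of $\mathcal F(\Omega)$). Let $\mathcal F(\Omega)_\gamma'$ be the space of $\gamma$-continuous linear functionals on $\mathcal F(\Omega)$ with the norm of the dual of $(\mathcal F(\Omega),\|\cdot\|)$. Then $\mathcal F(\Omega)_\gamma'$ is a Banach space,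 and $\mathcal I(f)(f')=f'(f)$ defines an isometric isomorphism $\mathcal I$ of $\mathcal F(\Omega)$ onto the dual of $\mathcal F(\Omega)_\gamma'$. Moreover, if $Z$ is a Banach space over $\mathbb K$ and $\widetilde T\colon\mathcal F(\Omega)\to Z^{*}$ is an isometric isomorphism onto the dual of $Z$, then the following assertions are equivalent. (a) There is a map $\widetilde\delta\colon\Omega\to Z$ such that $z^{*}\circ\widetilde\delta\in\mathcal F(\Omega)$ for all $z^{*}\in Z^{*}$ (i.e. $\widetilde\delta\in\mathcal F(\Omega,Z)_\sigma$) and $\widetilde T(f)\circ\widetilde\delta=f$ for all $f\in\mathcal F(\Omega)$ (i.e. $(\widetilde\delta,Z,\widetilde T)$ is a strong isometric Banach linearisation of $\mathcal F(\Omega)$). (b) $(Z,\widetilde T)$ and $(\mathcal F(\Omega)_\gamma',\mathcal I)$ are isometrically equivalent, i.e. there is an isometric isomorphism $\lambda\colon Z\to\mathcal F(\Omega)_\gamma'$ whose dual map $\lambda^{t}$, $\lambda^{t}(\Phi)=\Phi\circ\lambda$, satisfies $\lambda^{t}=\widetilde T\circ\mathcal I^{-1}$. -/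

import Mathlib

open scoped Topology

section MixedTopology

/-- The topology induced by the norm of a normed space. -/
abbrev normTopology (X : Type*) [NormedAddCommGroup X] : TopologicalSpace X := inferInstance

/-- The norm dual `X*` of a normed space, with the dual norm. (A separate name, so that the norm
topology of `X` is used even where another topology on `X` is a variable.) -/
abbrev NormDual (𝕜 X : Type*) [RCLike 𝕜] [NormedAddCommGroup X] [NormedSpace 𝕜 X] : Type _ :=
  StrongDual 𝕜 X

/-- `σ` is a linear (vector space) topology on the `𝕜`-vector space `X`. -/
structure IsVectorTopology (𝕜 : Type*) {X : Type*} [RCLike 𝕜] [AddCommGroup X] [Module 𝕜 X]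
    (σ : TopologicalSpace X) : Prop where
  topologicalAddGroup : @IsTopologicalAddGroup X σ _
  continuousSMul : @ContinuousSMul 𝕜 X _ _ σ

/-- A topological vector space is semi-reflexive if the evaluation map into the dual of its strong
dual is onto. For a topological vector space `X`, Mathlib's topology on `StrongDual 𝕜 X` is
the topology of uniform convergence on the (von Neumann) bounded subsets of `X`. -/
def IsSemireflexive (𝕜 X : Type*) [RCLike 𝕜] [AddCommGroup X] [Module 𝕜 X]
    [TopologicalSpace X] : Prop :=
  ∀ Φ : StrongDual 𝕜 (StrongDual 𝕜 X), ∃ x : X, ∀ u : StrongDual 𝕜 X, Φ u = u x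

variable (𝕜 : Type*) {X : Type*} [RCLike 𝕜] [NormedAddCommGroup X] [NormedSpace 𝕜 X]

/-- `(X, ‖·‖, τ)` is a pre-Saks space: `τ` is a locally convex Hausdorff topology on the normed
space `X` that is coarser than the norm topology. (In Mathlib `σ ≤ τ` means that `σ` is finer
than `τ`; being polynormable means that the topology is generated by a family of seminorms.) -/
structure IsPreSaks (τ : TopologicalSpace X) : Prop where
  locallyConvex : @PolynormableSpace 𝕜 X _ _ _ τ
  t2 : @T2Space X τ
  norm_le : normTopology X ≤ τ

/-- The linear topologies on `X` that coincide with `τ` on norm-bounded sets and lie between `τ`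
and the norm topology. -/
def mixedCandidates (τ : TopologicalSpace X) : Set (TopologicalSpace X) :=
  {σ | IsVectorTopology 𝕜 σ ∧ σ ≤ τ ∧ normTopology X ≤ σ ∧
    ∀ B : Set X, Bornology.IsBounded B →
      σ.induced (Subtype.val : B → X) = τ.induced (Subtype.val : B → X)}

/-- The mixed topology `γ(‖·‖, τ)`: the finest linear topology that coincides with `τ` on
norm-bounded sets and lies between `τ` and the norm topology. It is the finest such
topology by `isLeast_mixedTopology`. -/
@[reducible] def mixedTopology (τ : TopologicalSpace X) : TopologicalSpace X := sInf (mixedCandidates 𝕜 τ)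

theorem norm_le_mixedTopology (τ : TopologicalSpace X) :
    normTopology X ≤ mixedTopology 𝕜 τ :=
  le_sInf fun _ h => h.2.2.1

theorem IsPreSaks.isVectorTopology {τ : TopologicalSpace X} (h : IsPreSaks 𝕜 τ) :
    IsVectorTopology 𝕜 τ := by
  have hw := @PolynormableSpace.withSeminorms' 𝕜 X _ _ _ τ h.locallyConvex
  exact ⟨@WithSeminorms.topologicalAddGroup 𝕜 X _ _ _ _ τ _ hw,
    @WithSeminorms.continuousSMul 𝕜 X _ _ _ _ τ _ hw⟩

theorem isLeast_mixedTopology {τ : TopologicalSpace X} (h : IsPreSaks 𝕜 τ) :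
    IsLeast (mixedCandidates 𝕜 τ) (mixedTopology 𝕜 τ) := by
  have hτ : τ ∈ mixedCandidates 𝕜 τ :=
    ⟨h.isVectorTopology, le_rfl, h.norm_le, fun _ _ => rfl⟩
  refine ⟨⟨⟨?_, ?_⟩, sInf_le hτ, norm_le_mixedTopology 𝕜 τ, fun B hB => ?_⟩,
    fun σ hσ => sInf_le hσ⟩
  · exact topologicalAddGroup_sInf fun σ hσ => hσ.1.topologicalAddGroup
  · exact continuousSMul_sInf fun σ hσ => hσ.1.continuousSMul
  · rw [mixedTopology, sInf_eq_iInf', induced_iInf]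
    refine le_antisymm (iInf_le_of_le ⟨τ, hτ⟩ le_rfl) (le_iInf fun σ => ?_)
    exact (σ.2.2.2.2 B hB).ge

/-- `(X, ‖·‖, τ)` is a Saks space: a pre-Saks space such that `τ` is generated by a directed
system `Γ` of continuous seminorms with `‖x‖ = sup_{q ∈ Γ} q x` for all `x`. -/
structure IsSaks (τ : TopologicalSpace X) : Prop extends IsPreSaks 𝕜 τ where
  exists_seminorms : ∃ Γ : Set (Seminorm 𝕜 X), DirectedOn (· ≤ ·) Γ ∧
    (∀ q ∈ Γ, Continuous[τ, inferInstance] q) ∧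
    @WithSeminorms 𝕜 X Γ _ _ _ (fun q : Γ => (q : Seminorm 𝕜 X)) τ ∧
    ∀ x : X, IsLUB ((fun q : Seminorm 𝕜 X => q x) '' Γ) ‖x‖

/-- `(X, ‖·‖, τ)` is a semi-reflexive Saks space: a Saks space such that `X` with the mixed
topology is semi-reflexive. -/
structure IsSemireflexiveSaks (τ : TopologicalSpace X) : Prop extends IsSaks 𝕜 τ where
  semireflexive : @IsSemireflexive 𝕜 X _ _ _ (mixedTopology 𝕜 τ)

/-- The dual `X'_γ` of `X` with the mixed topology `γ`, as a subspace of the norm dual of `X`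
(the norm topology is finer than `γ`), with the restriction of the dual norm. -/
def mixedDual (τ : TopologicalSpace X) : Submodule 𝕜 (NormDual 𝕜 X) where
  carrier := {u | Continuous[mixedTopology 𝕜 τ, inferInstance] u}
  zero_mem' := @continuous_const _ _ (mixedTopology 𝕜 τ) _ 0
  add_mem' hu hv := @Continuous.add _ _ _ _ _ (mixedTopology 𝕜 τ) _ _ hu hv
  smul_mem' c _ hu := @Continuous.const_smul _ _ _ _ _ _ (mixedTopology 𝕜 τ) _ hu c

end MixedTopology

section Preduals

variable {𝕜 X Y Z : Type*} [RCLike 𝕜] [NormedAddCommGroup X] [NormedSpace 𝕜 X]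
  [NormedAddCommGroup Y] [NormedSpace 𝕜 Y] [NormedAddCommGroup Z] [NormedSpace 𝕜 Z]

/-- Two isometric preduals `(Y, φ)` and `(Z, ψ)` of `X` are isometrically equivalent if there is
an isometric isomorphism `l : Y → Z` whose dual map `Z* → Y*` is `φ ∘ ψ⁻¹`. -/
def IsometricallyEquivalent (φ : X ≃ₗᵢ[𝕜] NormDual 𝕜 Y) (ψ : X ≃ₗᵢ[𝕜] NormDual 𝕜 Z) : Prop :=
  ∃ l : Y ≃ₗᵢ[𝕜] Z, ∀ z' : NormDual 𝕜 Z,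
    z'.comp (l.toContinuousLinearEquiv : Y →L[𝕜] Z) = φ (ψ.symm z')

end Preduals

/-- A normed space of `𝕜`-valued functions on `Ω`: a linear subspace of `Ω → 𝕜`, with a norm on
this subspace. -/
structure NormedFunctionSpace (𝕜 Ω : Type*) [RCLike 𝕜] where
  toSubmodule : Submodule 𝕜 (Ω → 𝕜)
  seminorm : Seminorm 𝕜 toSubmodule
  eq_zero_of_seminorm : ∀ f, seminorm f = 0 → f = 0

namespace NormedFunctionSpace

variable {𝕜 Ω : Type*} [RCLike 𝕜]

/-- The elements of a normed space of functions, carrying its norm (and hence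
not the topology of pointwise convergence). -/
def Elem (F : NormedFunctionSpace 𝕜 Ω) : Type _ := F.toSubmodule

instance : CoeSort (NormedFunctionSpace 𝕜 Ω) (Type _) := ⟨Elem⟩

variable (F : NormedFunctionSpace 𝕜 Ω)

instance : FunLike F Ω 𝕜 where
  coe f := f.1
  coe_injective := Subtype.val_injective

instance : AddCommGroup F := inferInstanceAs (AddCommGroup F.toSubmodule)

instance : Module 𝕜 F := inferInstanceAs (Module 𝕜 F.toSubmodule)

noncomputable instance : NormedAddCommGroup F :=
  AddGroupNorm.toNormedAddCommGroup
    { toFun := F.seminorm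
      map_zero' := map_zero F.seminorm
      add_le' := map_add_le_add F.seminorm
      neg' := map_neg_eq_map F.seminorm
      eq_zero_of_map_eq_zero' := F.eq_zero_of_seminorm }

noncomputable instance : NormedSpace 𝕜 F where
  norm_smul_le c f := (map_smul_eq_mul F.seminorm c f).le

/-- The topology of pointwise convergence on `F`. -/
@[reducible] def pointwiseTopology : TopologicalSpace F :=
  TopologicalSpace.induced (fun (f : F) (x : Ω) => f x) Pi.topologicalSpace

/-- The weak vector-valued version `F(Ω, E)_σ` of `F`: all maps `g : Ω → E` such that
`e' ∘ g` belongs to `F` for every `e'` in the dual of `E`. -/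
def weakVectorValued (E : Type*) [NormedAddCommGroup E] [NormedSpace 𝕜 E] : Set (Ω → E) :=
  {g | ∀ e' : NormDual 𝕜 E, (fun x => e' (g x)) ∈ F.toSubmodule}

variable {F}

/-- `(δ, Y, T)` is a strong isometric Banach linearisation of `F`: `Y` is a Banach space and
`T` is an isometric isomorphism of `F` onto `Y*` such that `T f ∘ δ = f` for all `f` in `F`. -/
def IsStrongIsometricBanachLinearisation {Y : Type*} [NormedAddCommGroup Y] [NormedSpace 𝕜 Y]
    [CompleteSpace Y] (δ : Ω → Y) (T : F ≃ₗᵢ[𝕜] NormDual 𝕜 Y) : Prop :=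
  ∀ f : F, (T f : Y → 𝕜) ∘ δ = f

end NormedFunctionSpace

/-! A functional in `X*` is `γ`-continuous iff it is `τ`-continuous on norm-bounded sets. Norm
limits preserve this, so `X'_γ` is closed in `X*`, hence Banach. Evaluation of `X` on it is
isometric by Hahn–Banach applied to the Saks seminorms, and onto by semi-reflexivity, since the
strong topology on the dual of `(X, γ)` is finer than the dual norm.

For the equivalence, `T` embeds `Z` isometrically into `X*`, and (a) says that `δ ω` goes to
evaluation at `ω`, which lies in `X'_γ` because `τ` is finer than pointwise convergence. Point
evaluations separate `F`, and `F` represents both `Z*` and `(X'_γ)*`. So their span is dense in both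
preduals, and the image of `Z`, being complete, is exactly `X'_γ`. Conversely, `λ⁻¹` of the point
evaluations gives `δ`. -/

theorem Submodule.mem_of_isClosed_of_forall_dual {𝕜 E : Type*} [RCLike 𝕜] [NormedAddCommGroup E]
    [NormedSpace 𝕜 E] (p : Submodule 𝕜 E) (hp : IsClosed (p : Set E)) {x : E}
    (h : ∀ φ : StrongDual 𝕜 E, (∀ y ∈ p, φ y = 0) → φ x = 0) : x ∈ p := by
  have := hp
  by_contra hx
  have hne : (p.mkQ x) ≠ 0 := by simpa using hx
  obtain ⟨g, -, hg⟩ := exists_dual_vector 𝕜 (p.mkQ x) (norm_ne_zero_iff.2 hne)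
  have h0 := h (g.comp p.mkQL) fun y hy => by
    have : p.mkQ y = 0 := by simpa using hy
    change g (p.mkQ y) = 0
    rw [this, map_zero]
  have h1 : g (p.mkQ x) = 0 := h0
  rw [h1] at hg
  exact hne (norm_eq_zero.1 (by exact_mod_cast hg.symm))

/-- Completeness of `Z` makes the range closed, so a trivial annihilator forces it to be everything.
-/
theorem LinearIsometry.surjective_of_forall_dual {𝕜 E Z : Type*} [RCLike 𝕜]
    [NormedAddCommGroup E] [NormedSpace 𝕜 E] [NormedAddCommGroup Z] [NormedSpace 𝕜 Z]
    [CompleteSpace Z] (l : Z →ₗᵢ[𝕜] E)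
    (h : ∀ φ : StrongDual 𝕜 E, (∀ z, φ (l z) = 0) → φ = 0) : Function.Surjective l := fun x =>
  (LinearMap.range l.toLinearMap).mem_of_isClosed_of_forall_dual
    l.isometry.isClosedEmbedding.isClosed_range fun φ hφ => by
      rw [h φ fun z => hφ _ ⟨z, rfl⟩, zero_apply]

/-- A continuous seminorm on a polynormable space is attained at each point by a continuous
linear functional that it dominates. -/
theorem PolynormableSpace.exists_dual_apply_eq_seminorm {𝕜 E : Type*} [RCLike 𝕜] [AddCommGroup E]
    [Module 𝕜 E] [TopologicalSpace E] [PolynormableSpace 𝕜 E] {q : Seminorm 𝕜 E}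
    (hq : Continuous q) (x : E) :
    ∃ u : StrongDual 𝕜 E, u x = (q x : 𝕜) ∧ ∀ y, ‖u y‖ ≤ q y := by
  rcases eq_or_ne x 0 with rfl | hx
  · exact ⟨0, by simp, fun y => by simp⟩
  let e := LinearEquiv.toSpanNonzeroSingleton 𝕜 E x hx
  -- On the line through `x`, the functional `c • x ↦ c * q x` has modulus exactly `q`; Hahn–Banach
  -- extends it.
  let f : Module.Dual 𝕜 (Submodule.span 𝕜 {x}) := LinearMap.mulLeft 𝕜 (q x : 𝕜) ∘ₗ e.symm.toLinearMap
  have he : ∀ c : 𝕜, ((e c : Submodule.span 𝕜 {x}) : E) = c • x := fun c => rfl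
  obtain ⟨u, hu, hle⟩ := Module.Dual.exists_continuous_extension_of_le_seminorm
    (Submodule.span 𝕜 {x}) f hq fun y => by
      obtain ⟨c, rfl⟩ := e.surjective y
      simp [f, he, map_smul_eq_mul, abs_of_nonneg (apply_nonneg q x), mul_comm]
  refine ⟨u, ?_, hle⟩
  have := hu (e 1)
  rw [he, one_smul] at this
  simpa [f] using this

/-! ### The dual of the mixed topology as a predual -/

section Mixed

variable {𝕜 X : Type*} [RCLike 𝕜] [NormedAddCommGroup X] [NormedSpace 𝕜 X]

theorem NormDual.continuous (u : NormDual 𝕜 X) : Continuous[normTopology X, inferInstance] u :=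
  u.cont

/-- The evaluation map of `X` into the dual of a subspace of `X*`. -/
noncomputable def dualEval (S : Submodule 𝕜 (NormDual 𝕜 X)) : X →ₗ[𝕜] NormDual 𝕜 S :=
  (S.subtypeL.flip : X →L[𝕜] NormDual 𝕜 S).toLinearMap

theorem dualEval_apply (S : Submodule 𝕜 (NormDual 𝕜 X)) (x : X) (u : S) :
    dualEval S x u = (u : NormDual 𝕜 X) x := rfl

theorem norm_dualEval_le (S : Submodule 𝕜 (NormDual 𝕜 X)) (x : X) : ‖dualEval S x‖ ≤ ‖x‖ := by
  refine ContinuousLinearMap.opNorm_le_bound _ (norm_nonneg x) fun u => ?_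
  rw [dualEval_apply, mul_comm]
  exact (u : NormDual 𝕜 X).le_opNorm x

/-- `v` is a bare linear map so that functionals bundled as continuous for another topology on `X`
can be used. -/
theorem norm_le_norm_dualEval (S : Submodule 𝕜 (NormDual 𝕜 X)) (x : X) {v : X →ₗ[𝕜] 𝕜}
    (hv : ∀ y, ‖v y‖ ≤ 1 * ‖y‖) (hS : v.mkContinuous 1 hv ∈ S) : ‖v x‖ ≤ ‖dualEval S x‖ := by
  have h1 : ‖(⟨_, hS⟩ : S)‖ ≤ 1 := LinearMap.mkContinuous_norm_le v zero_le_one hv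
  simpa [dualEval_apply] using (dualEval S x).le_opNorm_of_le h1

theorem isVectorTopology_induced {E : Type*} [AddCommGroup E] [Module 𝕜 E] (v : E →ₗ[𝕜] 𝕜) :
    IsVectorTopology 𝕜 (TopologicalSpace.induced v inferInstance) :=
  ⟨topologicalAddGroup_induced v, continuousSMul_induced v⟩

theorem IsVectorTopology.inf {E : Type*} [AddCommGroup E] [Module 𝕜 E] {σ υ : TopologicalSpace E}
    (hσ : IsVectorTopology 𝕜 σ) (hυ : IsVectorTopology 𝕜 υ) : IsVectorTopology 𝕜 (σ ⊓ υ) :=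
  ⟨topologicalAddGroup_inf hσ.topologicalAddGroup hυ.topologicalAddGroup,
    @continuousSMul_inf _ _ _ _ _ _ hσ.continuousSMul hυ.continuousSMul⟩

theorem mem_mixedDual_of_continuous {τ : TopologicalSpace X} (h : IsPreSaks 𝕜 τ)
    {u : NormDual 𝕜 X} (hu : Continuous[τ, inferInstance] u) : u ∈ mixedDual 𝕜 τ :=
  continuous_le_dom (isLeast_mixedTopology 𝕜 h).1.2.1 hu

/-- A norm-continuous functional that is `τ`-continuous on bounded sets belongs to `X'_γ`. -/
theorem mem_mixedDual_of_continuousOn {τ : TopologicalSpace X} (h : IsPreSaks 𝕜 τ)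
    {u : NormDual 𝕜 X}
    (hu : ∀ B : Set X, Bornology.IsBounded B → @ContinuousOn X 𝕜 τ _ u B) :
    u ∈ mixedDual 𝕜 τ := by
  -- Adjoining to `τ` the coarsest topology making `u` continuous changes nothing on bounded sets,
  -- so `γ` is finer than the result.
  let υ : TopologicalSpace X := TopologicalSpace.induced u inferInstance
  suffices hσ : τ ⊓ υ ∈ mixedCandidates 𝕜 τ from
    continuous_iff_le_induced.2 (((isLeast_mixedTopology 𝕜 h).2 hσ).trans inf_le_right)
  refine ⟨h.isVectorTopology.inf (isVectorTopology_induced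
    (@ContinuousLinearMap.toLinearMap _ _ _ _ _ _ (_) _ _ _ _ _ _ u)), inf_le_left,
    le_inf h.norm_le (continuous_iff_le_induced.1 (NormDual.continuous u)), fun B hB => ?_⟩
  rw [induced_inf]
  refine le_antisymm inf_le_left (le_inf le_rfl ?_)
  rw [induced_compose]
  exact continuous_iff_le_induced.1
    ((@continuousOn_iff_continuous_domRestrict X 𝕜 τ _ u B).1 (hu B hB))

theorem continuousOn_of_mem_mixedDual {τ : TopologicalSpace X} (h : IsPreSaks 𝕜 τ)
    {u : NormDual 𝕜 X} (hu : u ∈ mixedDual 𝕜 τ) {B : Set X} (hB : Bornology.IsBounded B) :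
    @ContinuousOn X 𝕜 τ _ u B := by
  rw [@continuousOn_iff_continuous_domRestrict X 𝕜 τ _ u B, continuous_iff_le_induced]
  change τ.induced (Subtype.val : B → X) ≤ _
  rw [← (isLeast_mixedTopology 𝕜 h).1.2.2.2 B hB]
  exact continuous_iff_le_induced.1
    (@Continuous.comp _ _ _ (_) (mixedTopology 𝕜 τ) _ _ _ hu continuous_induced_dom)

theorem isClosed_mixedDual {τ : TopologicalSpace X} (h : IsPreSaks 𝕜 τ) :
    IsClosed (mixedDual 𝕜 τ : Set (NormDual 𝕜 X)) := by
  refine isClosed_of_closure_subset fun u hu => ?_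
  refine mem_mixedDual_of_continuousOn h fun B hB => ?_
  obtain ⟨C, hC, hBC⟩ := hB.exists_pos_norm_le
  refine @continuousOn_of_uniform_approx_of_continuousOn X 𝕜 τ _ u B fun s hs => ?_
  obtain ⟨ε, hε, hs⟩ := Metric.mem_uniformity_dist.1 hs
  -- `B` lies in the ball of radius `C`, so `v` is within `ε` of `u` on `B`.
  obtain ⟨v, hv, huv⟩ := Metric.mem_closure_iff.1 hu (ε / C) (div_pos hε hC)
  refine ⟨v, continuousOn_of_mem_mixedDual h hv hB, fun y hy => hs ?_⟩
  rw [dist_eq_norm] at huv ⊢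
  calc ‖u y - v y‖ = ‖(u - v) y‖ := by simp
    _ ≤ ‖u - v‖ * C := (u - v).le_opNorm_of_le (hBC y hy)
    _ < ε / C * C := by gcongr
    _ = ε := by field_simp

theorem norm_dualEval_mixedDual {τ : TopologicalSpace X} (h : IsSaks 𝕜 τ) (x : X) :
    ‖dualEval (mixedDual 𝕜 τ) x‖ = ‖x‖ := by
  refine le_antisymm (norm_dualEval_le _ x) ?_
  obtain ⟨Γ, -, hΓ, -, hlub⟩ := h.exists_seminorms
  refine (hlub x).2 ?_
  rintro _ ⟨q, hq, rfl⟩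
  obtain ⟨u, hux, hle⟩ := @PolynormableSpace.exists_dual_apply_eq_seminorm 𝕜 X _ _ _ τ
    h.locallyConvex q (hΓ q hq) x
  have hle' : ∀ y, ‖u y‖ ≤ 1 * ‖y‖ := fun y => by
    rw [one_mul]
    exact (hle y).trans ((hlub y).1 ⟨q, hq, rfl⟩)
  have hle'' := norm_le_norm_dualEval (mixedDual 𝕜 τ) x hle' (mem_mixedDual_of_continuous
    h.toIsPreSaks (@ContinuousLinearMap.cont _ _ _ _ _ _ τ _ _ _ _ _ _ u))
  change ‖u x‖ ≤ _ at hle''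
  rw [hux] at hle''
  simpa [abs_of_nonneg (apply_nonneg q x)] using hle''

/-- Precomposition with `e` is continuous from the strong dual of `Y`, so it pulls `Φ` back to the
strong bidual. The case needed is the identity from the norm to the mixed topology; a separate `Y`
keeps the two topologies apart. -/
theorem IsSemireflexive.exists_apply_comp_eq {Y : Type*} [AddCommGroup Y] [Module 𝕜 Y]
    [TopologicalSpace Y] (hY : IsSemireflexive 𝕜 Y) (e : X →L[𝕜] Y)
    (S : Submodule 𝕜 (NormDual 𝕜 X)) (hS : ∀ v : StrongDual 𝕜 Y, v.comp e ∈ S)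
    (Φ : NormDual 𝕜 S) : ∃ y : Y, ∀ v : StrongDual 𝕜 Y, Φ ⟨v.comp e, hS v⟩ = v y :=
  hY (Φ.comp ((ContinuousLinearMap.precomp 𝕜 e).codRestrict S hS))

theorem surjective_dualEval_mixedDual {τ : TopologicalSpace X} (h : IsSemireflexiveSaks 𝕜 τ) :
    Function.Surjective (dualEval (mixedDual 𝕜 τ)) := by
  intro Φ
  obtain ⟨x, hx⟩ := @IsSemireflexive.exists_apply_comp_eq 𝕜 X _ _ _ X _ _ (mixedTopology 𝕜 τ)
    h.semireflexive (@ContinuousLinearMap.mk _ _ _ _ _ _ (_) _ _ (mixedTopology 𝕜 τ) _ _ _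
      LinearMap.id (continuous_id_iff_le.2 (norm_le_mixedTopology 𝕜 τ))) (mixedDual 𝕜 τ)
    (fun v => @ContinuousLinearMap.cont _ _ _ _ _ _ (mixedTopology 𝕜 τ) _ _ _ _ _ _ v) Φ
  refine ⟨x, ContinuousLinearMap.ext fun u => ?_⟩
  exact (hx (@ContinuousLinearMap.mk _ _ _ _ _ _ (mixedTopology 𝕜 τ) _ _ _ _ _ _
    (@ContinuousLinearMap.toLinearMap _ _ _ _ _ _ (_) _ _ _ _ _ _ (u : NormDual 𝕜 X)) u.2)).symm

/-- The evaluation map of a semi-reflexive Saks space as an isometric isomorphism onto the dual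
of `X'_γ`. -/
noncomputable def mixedDualEquiv {τ : TopologicalSpace X} (h : IsSemireflexiveSaks 𝕜 τ) :
    X ≃ₗᵢ[𝕜] NormDual 𝕜 (mixedDual 𝕜 τ) :=
  LinearIsometryEquiv.ofSurjective ⟨dualEval (mixedDual 𝕜 τ), norm_dualEval_mixedDual h.toIsSaks⟩
    (surjective_dualEval_mixedDual h)

/-- The isometric embedding of `Z` into `X*` induced by an isometric isomorphism of `X` onto the
dual of `Z`. -/
noncomputable def predualEmbedding {Z : Type*} [NormedAddCommGroup Z] [NormedSpace 𝕜 Z]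
    (T : X ≃ₗᵢ[𝕜] NormDual 𝕜 Z) : Z →ₗᵢ[𝕜] NormDual 𝕜 X where
  toLinearMap := (T.toContinuousLinearEquiv : X →L[𝕜] NormDual 𝕜 Z).flip.toLinearMap
  norm_map' z := by
    refine le_antisymm ?_ ?_
    · refine ContinuousLinearMap.opNorm_le_bound _ (norm_nonneg z) fun x => ?_
      calc ‖T x z‖ ≤ ‖T x‖ * ‖z‖ := (T x).le_opNorm z
        _ = ‖z‖ * ‖x‖ := by rw [T.norm_map, mul_comm]
    · obtain ⟨g, hg, hgz⟩ := exists_dual_vector'' 𝕜 z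
      have hx : ‖T.symm g‖ ≤ 1 := by rwa [T.symm.norm_map]
      have := ContinuousLinearMap.le_opNorm_of_le
        ((T.toContinuousLinearEquiv : X →L[𝕜] NormDual 𝕜 Z).flip z) hx
      simpa [hgz] using this

theorem predualEmbedding_apply {Z : Type*} [NormedAddCommGroup Z] [NormedSpace 𝕜 Z]
    (T : X ≃ₗᵢ[𝕜] NormDual 𝕜 Z) (z : Z) (x : X) : predualEmbedding T z x = T x z := rfl

/-- If a closed subspace `S` of `X*` that is a predual of `X` by evaluation contains a separating
set of functionals that come from a predual `Z` of `X`, then `Z` and `S` are isometrically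
equivalent. -/
theorem isometricallyEquivalent_of_separating {Z ι : Type*} [NormedAddCommGroup Z]
    [NormedSpace 𝕜 Z] [CompleteSpace Z] {S : Submodule 𝕜 (NormDual 𝕜 X)}
    (hS : IsClosed (S : Set (NormDual 𝕜 X))) (e : X ≃ₗᵢ[𝕜] NormDual 𝕜 S)
    (he : ∀ (x : X) (u : S), e x u = (u : NormDual 𝕜 X) x)
    (T : X ≃ₗᵢ[𝕜] NormDual 𝕜 Z) (δ : ι → Z) (hδ : ∀ i, predualEmbedding T (δ i) ∈ S)
    (hsep : ∀ x : X, (∀ i, T x (δ i) = 0) → x = 0) :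
    IsometricallyEquivalent T e := by
  let j := predualEmbedding T
  have hmem : ∀ z, j z ∈ S := by
    intro z
    -- Every functional on `Z` is some `T x`; if it kills all `δ i`, separation gives `x = 0`.
    refine (S.comap j.toLinearMap).mem_of_isClosed_of_forall_dual
      (hS.preimage j.continuous) fun φ hφ => ?_
    have : T.symm φ = 0 := hsep _ fun i => by
      rw [T.apply_symm_apply]
      exact hφ _ (hδ i)
    rw [(map_eq_zero_iff T.symm T.symm.injective).1 this]
    rfl
  let l : Z →ₗᵢ[𝕜] S := ⟨j.toLinearMap.codRestrict _ hmem, j.norm_map⟩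
  have hsurj : Function.Surjective l := by
    -- The same separation argument in `S`, whose functionals are the `e x`.
    refine LinearIsometry.surjective_of_forall_dual (𝕜 := 𝕜) (E := S) l fun Φ hΦ => ?_
    obtain ⟨x, rfl⟩ := e.surjective Φ
    have hx : x = 0 := hsep x fun i => (he x (l (δ i))).symm.trans (hΦ (δ i))
    rw [hx, map_zero]
  refine ⟨LinearIsometryEquiv.ofSurjective l hsurj, fun Φ => ?_⟩
  obtain ⟨x, rfl⟩ := e.surjective Φ
  rw [LinearIsometryEquiv.symm_apply_apply]
  exact ContinuousLinearMap.ext fun z => he x (l z)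

end Mixed

/-! ### Point evaluations and the main theorem -/

namespace NormedFunctionSpace

variable {𝕜 Ω : Type*} [RCLike 𝕜] {F : NormedFunctionSpace 𝕜 Ω}

theorem continuous_pointwiseTopology_eval (ω : Ω) :
    Continuous[F.pointwiseTopology, inferInstance] (fun f : F => f ω) :=
  @Continuous.comp _ _ _ F.pointwiseTopology _ _ _ _ (continuous_apply ω) continuous_induced_dom

variable (F) in
/-- The evaluation of the elements of `F` at a point, as a linear functional. -/
def evalLinear (ω : Ω) : F →ₗ[𝕜] 𝕜 where
  toFun f := f ω
  map_add' _ _ := rfl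
  map_smul' _ _ := rfl

theorem exists_normDual_eval (ω : Ω)
    (hc : Continuous[normTopology F, inferInstance] (fun f : F => f ω)) :
    ∃ u : NormDual 𝕜 F, ∀ f : F, u f = f ω :=
  ⟨⟨F.evalLinear ω, hc⟩, fun _ => rfl⟩

theorem exists_mem_mixedDual_eval {τ : TopologicalSpace F} (h : IsPreSaks 𝕜 τ)
    (hp : τ ≤ F.pointwiseTopology) (ω : Ω) :
    ∃ u ∈ mixedDual 𝕜 τ, ∀ f : F, u f = f ω := by
  have hc := continuous_le_dom hp (continuous_pointwiseTopology_eval (F := F) ω)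
  obtain ⟨u, hu⟩ := exists_normDual_eval ω (continuous_le_dom h.norm_le hc)
  exact ⟨u, mem_mixedDual_of_continuous h (by rwa [funext hu]), hu⟩

end NormedFunctionSpace

theorem theorem5 {𝕜 Ω Z : Type*} [RCLike 𝕜] [Nonempty Ω] (F : NormedFunctionSpace 𝕜 Ω)
    (τ : TopologicalSpace F) (hτ : IsSemireflexiveSaks 𝕜 τ) (hp : τ ≤ F.pointwiseTopology)
    [NormedAddCommGroup Z] [NormedSpace 𝕜 Z] [CompleteSpace Z]
    (T : F ≃ₗᵢ[𝕜] NormDual 𝕜 Z) :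
    -- the canonical pair `(F'_γ, I)`, `I f u = u f`, is an isometric Banach predual of `F`
    CompleteSpace (mixedDual 𝕜 τ) ∧
    ∃ I : F ≃ₗᵢ[𝕜] NormDual 𝕜 (mixedDual 𝕜 τ),
      (∀ (f : F) (u : mixedDual 𝕜 τ), I f u = (u : NormDual 𝕜 F) f) ∧
      -- and the two assertions are equivalent
      ((∃ δ ∈ F.weakVectorValued Z,
          NormedFunctionSpace.IsStrongIsometricBanachLinearisation δ T) ↔
        IsometricallyEquivalent T I) := by
  have hτ' := hτ.toIsPreSaks
  refine ⟨(isClosed_mixedDual hτ').completeSpace_coe, mixedDualEquiv hτ, fun _ _ => rfl, ?_, ?_⟩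
  · rintro ⟨δ, -, hδ⟩
    have hδ' : ∀ (f : F) ω, T f (δ ω) = f ω := fun f ω => congrFun (hδ f) ω
    refine isometricallyEquivalent_of_separating (isClosed_mixedDual hτ')
      (mixedDualEquiv hτ) (fun _ _ => rfl) T δ (fun ω => ?_) fun f hf => ?_
    · obtain ⟨u, hu, huf⟩ := NormedFunctionSpace.exists_mem_mixedDual_eval hτ' hp ω
      have huδ : predualEmbedding T (δ ω) = u := DFunLike.ext _ _ fun f => by
        rw [huf, predualEmbedding_apply, hδ']
      rwa [huδ]
    · exact DFunLike.ext f 0 fun ω => by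
        rw [← hδ', hf]
        rfl
  · rintro ⟨l, hl⟩
    choose u hu huf using NormedFunctionSpace.exists_mem_mixedDual_eval hτ' hp
    -- `δ ω` is the preimage under `l` of evaluation at `ω`; `T f` is the functional `I f` composed
    -- with `l`.
    have key : ∀ (f : F) ω, T f (l.symm ⟨u ω, hu ω⟩) = f ω := fun f ω => by
      have := hl (mixedDualEquiv hτ f)
      rw [LinearIsometryEquiv.symm_apply_apply] at this
      rw [← this, ← huf ω f]
      change mixedDualEquiv hτ f (l (l.symm ⟨u ω, hu ω⟩)) = _
      rw [l.apply_symm_apply]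
      rfl
    refine ⟨fun ω => l.symm ⟨u ω, hu ω⟩, fun z' => ?_, fun f => funext (key f)⟩
    -- Weak membership follows from `key` at `f = T.symm z'`.
    have hz : (fun ω => z' (l.symm ⟨u ω, hu ω⟩)) = (T.symm z' : F) := by
      ext ω
      rw [← key, T.apply_symm_apply]
    rw [hz]
    exact (T.symm z').2
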